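/- **Theorem.** Let $p,k\ge 1$ be integers with $p+k\le n$, let $Z_i=(X_i,Y_i)$, $1\le i\le n$, be i.i.d. random variables with values in $\mathbb{R}^d\times\{0,1\}$, and assume that almost surely there are no distance ties, i.e. $\|X_i-X_j\|\neq\|X_i-X_l\|$ for all distinct $i,j,l$. For $e\subset\{1,\dots,n\}$ with $|e|\ge k$, let $\hat f_k(Z^e;x)=1$ if $\frac1k\sum_{i\in V_k^e(x)}Y_i>\frac12$ and $\hat f_k(Z^e;x)=0$ otherwise, where $V_k^e(x)$ is the set of indices of the $k$ nearest neighbours of $x$ (for the Euclidean norm) among the $X_i$, $i\in e$. Let $$\widehat R_p(\hat f_k)=\binom np^{-1}\sum_{e\subset\{1,\dots,n\},\,|e|=n-p}\ \frac1p\sum_{i\notin e}\mathbf 1_{\{\hat f_k(Z^e;X_i)\ne Y_i\}}$$ be the leave-$p$-out estimator of the classification error of the $k$-nearest-neighbour classifier. Then, with the constant $\square = 1024\,e\,\kappa\,(1+\gamma_d)>0$, for every $t>0$, $$\mathbb P\big(\widehat R_p(\hat f_k)-\mathbb E[\widehat R_p(\hat f_k)]>t\big)\ \vee\ \mathbb P\big(\mathbb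 E[\widehat R_p(\hat f_k)]-\widehat R_p(\hat f_k)>t\big)\ \le\ \exp\left(-\frac{n t^2}{\square\, k^2\left[1+(k+p)\frac{p-1}{n-1}\right]}\right).$$ Here $\kappa=\frac{\sqrt e}{2(\sqrt e-1)}\le 1.271$ is the universal constant of the generalized Efron–Stein moment inequality, and $\gamma_d$, which depends only on $d$, is the constant of Stone's lemma: the smallest real number such that, for all $m,r\ge 0$ and all points $x_1,\dots,x_m\in\mathbb R^d$ without distance ties, each of these points is among the $r$ nearest neighbours of at most $r\gamma_d$ of the other points (the neighbours of $x_i$ being taken among the $x_j$, $j\ne i$). -/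

import Mathlib

namespace KNN

/-- No distance ties: for three distinct indices `i, j, l`, the points `x j` and `x l` are at
different distances from `x i`. Then the nearest neighbours of each sample point among the other
ones are uniquely determined. -/
def NoDistanceTies {d n : ℕ} (x : Fin n → EuclideanSpace ℝ (Fin d)) : Prop :=
  ∀ i j l : Fin n, i ≠ j → i ≠ l → j ≠ l → dist (x i) (x j) ≠ dist (x i) (x l)

/-- The set `V_k^e(a)` of the indices of the `k` nearest neighbours of `a` among the points
`x j`, `j ∈ e`: the index `j ∈ e` belongs to it when fewer than `k` of these points are strictly
closer to `a` than `x j`. -/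
noncomputable def neighbors {d n : ℕ} (k : ℕ) (x : Fin n → EuclideanSpace ℝ (Fin d))
    (e : Finset (Fin n)) (a : EuclideanSpace ℝ (Fin d)) : Finset (Fin n) :=
  e.filter fun j => (e.filter fun l => dist a (x l) < dist a (x j)).card < k

/-- The `k`-nearest-neighbour classifier trained on the subsample `(z j)`, `j ∈ e`, evaluated at
`a`: majority vote over the labels of the `k` nearest neighbours of `a`. -/
noncomputable def classifier {d n : ℕ} (k : ℕ) (z : Fin n → EuclideanSpace ℝ (Fin d) × Fin 2)
    (e : Finset (Fin n)) (a : EuclideanSpace ℝ (Fin d)) : Fin 2 :=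
  if (1 / (k : ℝ)) * ∑ j ∈ neighbors k (fun i => (z i).1) e a, (((z j).2 : ℕ) : ℝ) > 1 / 2
  then 1 else 0

/-- The leave-`p`-out estimator of the classification error of the `k`-nearest-neighbour
classifier on the sample `z`: the average over all training sets `e` of `n - p` indices of the
proportion of errors on the `p` indices outside `e`. -/
noncomputable def leavePOut {d n : ℕ} (p k : ℕ)
    (z : Fin n → EuclideanSpace ℝ (Fin d) × Fin 2) : ℝ :=
  ((n.choose p : ℕ) : ℝ)⁻¹ * ∑ e ∈ (Finset.univ : Finset (Fin n)).powersetCard (n - p),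
    (1 / (p : ℝ)) * ∑ i ∈ eᶜ, if classifier k z e (z i).1 ≠ (z i).2 then 1 else 0

/-- `γ` is a valid constant in Stone's lemma in dimension `d`: among any finite number of points
without distance ties, each point is one of the `k` nearest neighbours of at most `k γ` of the
other points, where the neighbours of `x i` are taken among the points other than `x i`. -/
def IsStoneConstant (d : ℕ) (γ : ℝ) : Prop :=
  ∀ (n k : ℕ) (x : Fin n → EuclideanSpace ℝ (Fin d)), NoDistanceTies x → ∀ j : Fin n,
    (((Finset.univ.filter fun i : Fin n =>
      i ≠ j ∧ j ∈ neighbors k x (Finset.univ.erase i) (x i)).card : ℕ) : ℝ) ≤ k * γ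

/-- The constant `γ_d` of Stone's lemma: the least valid one. -/
noncomputable def stoneConstant (d : ℕ) : ℝ := sInf {γ : ℝ | IsStoneConstant d γ}

/-- The universal constant `κ` of the generalized Efron-Stein moment inequality. -/
noncomputable def kappa : ℝ :=
  Real.sqrt (Real.exp 1) / (2 * (Real.sqrt (Real.exp 1) - 1))

theorem kappa_le : kappa ≤ 1.271 := by
  have h : (1.6486 : ℝ) < Real.sqrt (Real.exp 1) := by
    apply Real.lt_sqrt_of_sq_lt
    have := Real.exp_one_gt_d9
    norm_num at this ⊢
    linarith
  unfold kappa
  rw [div_le_iff₀ (by linarith)]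
  norm_num at h ⊢
  linarith

/-- The constant `1024 e κ (1 + γ_d)`. -/
noncomputable def squareConstant (d : ℕ) : ℝ :=
  1024 * Real.exp 1 * kappa * (1 + stoneConstant d)

end KNN

/-! The proof is the entropy method with explicit comparison functions. Let f be the estimator and
F_j the same double sum with observation j deleted. The error at a training set e and a test index i
changes only if i = j or x_j is among the k neighbours of x_i in e. With D = C(n-1, p-1) and A_j the
number of pairs (e, i) of the second kind, this gives |f - F_j| ≤ (D + A_j)/(nD). Stone's lemma
yields A_j ≤ kγD, and counting the at most k neighbours of each test point yields ∑ A_j ≤ nDk.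
Bounding one factor of A_j² by the former and summing the other by the latter, ∑ (f - F_j)² ≤ v =
k²(3 + γ)/n, with no dependence on p.

Subadditivity of entropy (`entropy_le_sum`), used with g = exp(sf) and u_j = exp(sF_j), bounds the
entropy of exp(sf) by v s² E[exp(sf)] as long as s|f - F_j| ≤ 1. Herbst's argument and Chernoff's
bound then give the tail exp(-t²/(4v)). The restriction on s is harmless: f lies in [0, 1], so only
t < 1 matters. The stated bound is weaker, since 4(3 + γ) ≤ 512(1 + γ) ≤ □ and the bracket is at
least 1. -/

open MeasureTheory

/-! ### Coordinate averages and subadditivity of entropy on product spaces. -/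

section CoordAvg

variable {ι : Type*} [DecidableEq ι] {E : ι → Type*} [∀ i, MeasurableSpace (E i)]

/-- The average of `F` over the coordinate `j`, the others being fixed. -/
noncomputable def coordAvg (ν : ∀ i, Measure (E i)) (j : ι) (F : (∀ i, E i) → ℝ)
    (z : ∀ i, E i) : ℝ := ∫ y, F (Function.update z j y) ∂ν j

/-- Iterated averages over the coordinates in a list. -/
noncomputable def coordAvgList (ν : ∀ i, Measure (E i)) (l : List ι) (F : (∀ i, E i) → ℝ) :
    (∀ i, E i) → ℝ := l.foldl (fun G j => coordAvg ν j G) F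

theorem integrable_of_mem_Icc {α : Type*} [MeasurableSpace α] {μ : Measure α} [IsFiniteMeasure μ]
    {F : α → ℝ} (hF : Measurable F) {a b : ℝ} (hb : ∀ z, F z ∈ Set.Icc a b) : Integrable F μ :=
  Integrable.of_mem_Icc a b hF.aemeasurable (Filter.Eventually.of_forall hb)

theorem integrable_mul_of_mem_Icc {α : Type*} [MeasurableSpace α] {μ : Measure α}
    [IsFiniteMeasure μ] {F G : α → ℝ} (hF : Measurable F) (hG : Measurable G) {a b c d : ℝ}
    (hFb : ∀ z, F z ∈ Set.Icc a b) (hGb : ∀ z, G z ∈ Set.Icc c d) :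
    Integrable (fun z => F z * G z) μ := by
  refine (integrable_of_mem_Icc hF hFb).mul_bdd (c := max |c| |d|)
    hG.aestronglyMeasurable (Filter.Eventually.of_forall fun z => ?_)
  exact abs_le_max_abs_abs (hGb z).1 (hGb z).2

theorem log_mem_Icc {a b x : ℝ} (ha : 0 < a) (hx : x ∈ Set.Icc a b) :
    Real.log x ∈ Set.Icc (Real.log a) (Real.log b) :=
  ⟨Real.log_le_log ha hx.1, Real.log_le_log (ha.trans_le hx.1) hx.2⟩

theorem integrable_mul_log {α : Type*} [MeasurableSpace α] {μ : Measure α}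
    [IsFiniteMeasure μ] {F G : α → ℝ} (hF : Measurable F) (hG : Measurable G) {a b : ℝ}
    (ha : 0 < a) (hFb : ∀ z, F z ∈ Set.Icc a b) (hGb : ∀ z, G z ∈ Set.Icc a b) :
    Integrable (fun z => F z * Real.log (G z)) μ :=
  integrable_mul_of_mem_Icc hF hG.log hFb fun z => log_mem_Icc ha (hGb z)

theorem measurable_update_pair (j : ι) :
    Measurable fun q : (∀ i, E i) × E j => Function.update q.1 j q.2 := by
  refine measurable_pi_lambda _ fun i => ?_
  by_cases h : i = j
  · subst h; simpa using measurable_snd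
  · simpa [Function.update_of_ne h, Function.comp_def] using
      (measurable_pi_apply i).comp (measurable_fst (β := E j))

theorem dependsOn_coordAvg {ν : ∀ i, Measure (E i)} (j : ι) {F : (∀ i, E i) → ℝ}
    {s : Set ι} (hF : DependsOn F s) :
    DependsOn (coordAvg ν j F) (s \ {j}) := by
  intro z z' h
  refine integral_congr_ae (Filter.Eventually.of_forall fun y => hF fun i hi => ?_)
  by_cases hij : i = j
  · subst hij; simp
  · simpa [hij] using h i ⟨hi, hij⟩

theorem dependsOn_coordAvgList {ν : ∀ i, Measure (E i)} (l : List ι)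
    {F : (∀ i, E i) → ℝ} {s : Set ι} (hF : DependsOn F s) : DependsOn (coordAvgList ν l F) (s \ {i | i ∈ l}) := by
  induction l generalizing F s with
  | nil => simpa [coordAvgList] using hF
  | cons j l ih =>
    have h := ih (dependsOn_coordAvg (ν := ν) j hF)
    have hs : s \ {i | i ∈ j :: l} = (s \ {j}) \ {i | i ∈ l} := by
      ext i; simp; tauto
    rw [hs]
    exact h

theorem measurable_coordAvg {ν : ∀ i, Measure (E i)} [∀ i, IsProbabilityMeasure (ν i)]
    (j : ι) {F : (∀ i, E i) → ℝ} (hF : Measurable F) :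
    Measurable (coordAvg ν j F) :=
  ((hF.comp (measurable_update_pair j)).stronglyMeasurable.integral_prod_right'
    (ν := ν j)).measurable

theorem coordAvg_mem_Icc {ν : ∀ i, Measure (E i)} [∀ i, IsProbabilityMeasure (ν i)]
    (j : ι) {F : (∀ i, E i) → ℝ} (hF : Measurable F) {a b : ℝ}
    (hb : ∀ z, F z ∈ Set.Icc a b) (z : ∀ i, E i) : coordAvg ν j F z ∈ Set.Icc a b := by
  have hi : Integrable (fun y => F (Function.update z j y)) (ν j) :=
    integrable_of_mem_Icc (hF.comp (measurable_update z)) fun y => hb _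
  unfold coordAvg
  constructor
  · simpa using integral_mono (integrable_const a) hi fun y => (hb (Function.update z j y)).1
  · simpa using integral_mono hi (integrable_const b) fun y => (hb (Function.update z j y)).2

variable [Fintype ι] (ν : ∀ i, Measure (E i)) [∀ i, IsProbabilityMeasure (ν i)]

/-- Redrawing one coordinate independently preserves a product law; it suffices to compare measures
of boxes. -/
theorem measurePreserving_update (j : ι) :
    MeasurePreserving (fun q : (∀ i, E i) × E j => Function.update q.1 j q.2)
      ((Measure.pi ν).prod (ν j)) (Measure.pi ν) := by
  refine ⟨measurable_update_pair j, (Measure.pi_eq fun s hs => ?_).symm⟩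
  rw [Measure.map_apply (measurable_update_pair j) (MeasurableSet.univ_pi hs)]
  have : (fun q : (∀ i, E i) × E j => Function.update q.1 j q.2) ⁻¹' (Set.univ.pi s)
      = (Set.univ.pi (Function.update s j Set.univ)) ×ˢ s j := by
    ext q
    simp only [Set.mem_preimage, Set.mem_univ_pi, Set.mem_prod]
    constructor
    · intro h
      refine ⟨fun i => ?_, by simpa using h j⟩
      by_cases hi : i = j
      · subst hi; simp
      · simpa [hi] using h i
    · rintro ⟨h, h'⟩ i
      by_cases hi : i = j
      · subst hi; simpa using h'
      · simpa [hi] using h i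
  rw [this, Measure.prod_prod, Measure.pi_pi, ← Finset.prod_erase_mul _ _ (Finset.mem_univ j),
    ← Finset.prod_erase_mul _ (fun i => ν i (s i)) (Finset.mem_univ j)]
  simp only [Function.update_self, measure_univ, mul_one]
  congr 1
  exact Finset.prod_congr rfl fun i hi => by
    rw [Function.update_of_ne (Finset.ne_of_mem_erase hi)]

variable {ν}

theorem integral_coordAvg (j : ι) {F : (∀ i, E i) → ℝ} (hF : Measurable F)
    (hi : Integrable F (Measure.pi ν)) :
    ∫ z, coordAvg ν j F z ∂Measure.pi ν = ∫ z, F z ∂Measure.pi ν := by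
  have hp := measurePreserving_update ν j
  have h1 : Integrable (fun q : (∀ i, E i) × E j => F (Function.update q.1 j q.2))
      ((Measure.pi ν).prod (ν j)) := hp.integrable_comp_of_integrable hi
  unfold coordAvg
  rw [← integral_prod _ h1]
  conv_rhs => rw [← hp.map_eq, integral_map hp.measurable.aemeasurable hF.aestronglyMeasurable]

theorem coordAvgList_spec (l : List ι) {F : (∀ i, E i) → ℝ} (hF : Measurable F) {a b : ℝ}
    (hb : ∀ z, F z ∈ Set.Icc a b) :
    Measurable (coordAvgList ν l F) ∧ (∀ z, coordAvgList ν l F z ∈ Set.Icc a b) ∧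
      ∫ z, coordAvgList ν l F z ∂Measure.pi ν = ∫ z, F z ∂Measure.pi ν := by
  induction l generalizing F with
  | nil => exact ⟨hF, hb, rfl⟩
  | cons j l ih =>
    have h := ih (measurable_coordAvg (ν := ν) j hF) (coordAvg_mem_Icc j hF hb)
    exact ⟨h.1, h.2.1, h.2.2.trans (integral_coordAvg j hF (integrable_of_mem_Icc hF hb))⟩

/-- Once every coordinate is averaged out the result is constant, and each average preserves the
integral. -/
theorem coordAvgList_univ {F : (∀ i, E i) → ℝ} (hF : Measurable F) {a b : ℝ}
    (hb : ∀ z, F z ∈ Set.Icc a b) (z : ∀ i, E i) :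
    coordAvgList ν Finset.univ.toList F z = ∫ z, F z ∂Measure.pi ν := by
  have h := dependsOn_coordAvgList (ν := ν) (Finset.univ : Finset ι).toList (dependsOn_univ F)
  have hc : ∀ z', coordAvgList ν Finset.univ.toList F z'
      = coordAvgList ν Finset.univ.toList F z := fun z' => h fun i hi => by simp at hi
  rw [← (coordAvgList_spec Finset.univ.toList hF hb).2.2]
  simp [hc]

/-- This is log x ≥ 1 - 1/x at x = gA/(uT), multiplied by g. The right side is linear in T, so it
can be averaged over a coordinate. -/
theorem mul_log_div_le {g u T A : ℝ} (hg : 0 < g) (hu : 0 < u) (hT : 0 < T) (hA : 0 < A) :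
    g * Real.log T - g * Real.log A ≤
      (g * Real.log g - g * Real.log u - g) + u / A * T := by
  have h := Real.one_sub_inv_le_log_of_pos (x := g * A / (u * T)) (by positivity)
  rw [Real.log_div (by positivity) (by positivity), Real.log_mul hg.ne' hA.ne',
    Real.log_mul hu.ne' hT.ne'] at h
  have h2 := mul_le_mul_of_nonneg_left h hg.le
  have h3 : g * (1 - (g * A / (u * T))⁻¹) = g - u / A * T := by field_simp
  rw [h3] at h2
  linarith

/-- One step of the subadditivity of entropy: an average over the coordinate `j` costs at most the
entropy-like term with any comparison function `u` not depending on the coordinate `j`. -/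
theorem integral_mul_log_sub_coordAvg_le (j : ι) {g u T : (∀ i, E i) → ℝ} {a b : ℝ} (ha : 0 < a)
    (hg : Measurable g) (hu : Measurable u) (hT : Measurable T)
    (hgb : ∀ z, g z ∈ Set.Icc a b) (hub : ∀ z, u z ∈ Set.Icc a b) (hTb : ∀ z, T z ∈ Set.Icc a b)
    (huj : ∀ z y, u (Function.update z j y) = u z) :
    ∫ z, g z * Real.log (T z) ∂Measure.pi ν
      - ∫ z, g z * Real.log (coordAvg ν j T z) ∂Measure.pi ν
      ≤ ∫ z, (g z * Real.log (g z) - g z * Real.log (u z) - g z + u z) ∂Measure.pi ν := by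
  set A := coordAvg ν j T with hA
  have hAm : Measurable A := measurable_coordAvg j hT
  have hAb : ∀ z, A z ∈ Set.Icc a b := coordAvg_mem_Icc j hT hTb
  have hpos : ∀ {x}, x ∈ Set.Icc a b → 0 < x := fun hx => ha.trans_le hx.1
  have hdb : ∀ z, u z / A z ∈ Set.Icc 0 (b / a) := fun z =>
    ⟨div_nonneg (hpos (hub z)).le (hpos (hAb z)).le,
      div_le_div₀ ((hpos (hub z)).le.trans (hub z).2) (hub z).2 ha (hAb z).1⟩
  have hAj : ∀ z y, A (Function.update z j y) = A z := fun z y => by simp [hA, coordAvg]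
  have hint : Integrable (fun z => u z / A z * T z) (Measure.pi ν) :=
    integrable_mul_of_mem_Icc (hu.div hAm) hT hdb hTb
  -- Neither u nor A depends on coordinate j, so averaging over j turns T into A, which cancels.
  have key : ∫ z, u z / A z * T z ∂Measure.pi ν = ∫ z, u z ∂Measure.pi ν := by
    refine (integral_coordAvg j ((hu.div hAm).mul hT) hint).symm.trans ?_
    congr 1
    ext z
    have : coordAvg ν j ((u / A) * T) z = u z / A z * A z := by
      simp only [coordAvg, Pi.mul_apply, Pi.div_apply, huj, hAj, integral_const_mul]
      rfl
    rw [this, div_mul_cancel₀ _ (hpos (hAb z)).ne']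
  have i1 := integrable_mul_log (μ := Measure.pi ν) hg hT ha hgb hTb
  have i2 := integrable_mul_log (μ := Measure.pi ν) hg hAm ha hgb hAb
  have i3 := ((integrable_mul_log (μ := Measure.pi ν) hg hg ha hgb hgb).sub
    (integrable_mul_log (μ := Measure.pi ν) hg hu ha hgb hub)).sub
    (integrable_of_mem_Icc (μ := Measure.pi ν) hg hgb)
  have i4 := integrable_of_mem_Icc (μ := Measure.pi ν) hu hub
  rw [← integral_sub i1 i2]
  calc _ ≤ ∫ z, ((g z * Real.log (g z) - g z * Real.log (u z) - g z) + u z / A z * T z)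
          ∂Measure.pi ν := by
        refine integral_mono (i1.sub i2) (i3.add hint) fun z => ?_
        exact mul_log_div_le (hpos (hgb z)) (hpos (hub z)) (hpos (hTb z)) (hpos (hAb z))
    _ = _ := by
        refine (integral_add i3 hint).trans ?_
        rw [key]
        exact (integral_add i3 i4).symm

/-- Subadditivity of entropy on a product space, in its variational form. -/
theorem entropy_le_sum {g : (∀ i, E i) → ℝ} {u : ι → (∀ i, E i) → ℝ} {a b : ℝ}
    (ha : 0 < a) (hg : Measurable g) (hu : ∀ j, Measurable (u j))
    (hgb : ∀ z, g z ∈ Set.Icc a b) (hub : ∀ j z, u j z ∈ Set.Icc a b)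
    (huj : ∀ j z y, u j (Function.update z j y) = u j z) :
    ∫ z, g z * Real.log (g z) ∂Measure.pi ν
      - (∫ z, g z ∂Measure.pi ν) * Real.log (∫ z, g z ∂Measure.pi ν)
      ≤ ∑ j, ∫ z, (g z * Real.log (g z) - g z * Real.log (u j z) - g z + u j z)
          ∂Measure.pi ν := by
  -- Telescoping: start from T = g and average one coordinate at a time down to the constant E[g].
  -- The function T changes along the way, hence the induction for all T with g fixed.
  have key : ∀ (l : List ι) {T : (∀ i, E i) → ℝ}, Measurable T → (∀ z, T z ∈ Set.Icc a b) →
      ∫ z, g z * Real.log (T z) ∂Measure.pi ν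
        - ∫ z, g z * Real.log (coordAvgList ν l T z) ∂Measure.pi ν
      ≤ (l.map fun j => ∫ z, (g z * Real.log (g z) - g z * Real.log (u j z) - g z + u j z)
          ∂Measure.pi ν).sum := by
    intro l
    induction l with
    | nil => intro T _ _; simp [coordAvgList]
    | cons j l ih =>
      intro T hT hTb
      have h1 := integral_mul_log_sub_coordAvg_le (ν := ν) j ha hg (hu j) hT hgb (hub j) hTb
        (huj j)
      have h2 := ih (measurable_coordAvg (ν := ν) j hT) (coordAvg_mem_Icc j hT hTb)
      have h3 : coordAvgList ν (j :: l) T = coordAvgList ν l (coordAvg ν j T) := rfl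
      rw [List.map_cons, List.sum_cons, h3]
      linarith
  have h := key Finset.univ.toList hg hgb
  simp only [coordAvgList_univ hg hgb, integral_mul_const, Finset.sum_map_toList] at h
  exact h

end CoordAvg

/-! ### From entropy bounds to exponential tails. -/

section Concentration

open ProbabilityTheory

variable {ι : Type*} [DecidableEq ι] [Fintype ι] {E : ι → Type*} [∀ i, MeasurableSpace (E i)]
  {ν : ∀ i, Measure (E i)} [∀ i, IsProbabilityMeasure (ν i)]

theorem mul_mem_Icc_of_abs_le {x B : ℝ} (s : ℝ) (hx : |x| ≤ B) :
    s * x ∈ Set.Icc (-(|s| * B)) (|s| * B) := by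
  refine abs_le.1 ?_
  rw [abs_mul]
  exact mul_le_mul_of_nonneg_left hx (abs_nonneg s)

theorem exp_mul_mem_Icc {x B : ℝ} (s : ℝ) (hx : |x| ≤ B) :
    Real.exp (s * x) ∈ Set.Icc (Real.exp (-(|s| * B))) (Real.exp (|s| * B)) :=
  ⟨Real.exp_le_exp.2 (mul_mem_Icc_of_abs_le s hx).1,
    Real.exp_le_exp.2 (mul_mem_Icc_of_abs_le s hx).2⟩

/-- With g = exp(sf) and u_j = exp(sF_j), the j-th term of subadditivity is exp(sf)(exp x - 1 - x)
for x = -s(f - F_j). It is at most exp(sf) x² because |x| ≤ sM ≤ 1. -/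
theorem entropy_exp_le {f : (∀ i, E i) → ℝ} {F : ι → (∀ i, E i) → ℝ} {B M v s : ℝ}
    (hf : Measurable f) (hF : ∀ j, Measurable (F j)) (hfB : ∀ z, |f z| ≤ B)
    (hFB : ∀ j z, |F j z| ≤ B) (hFj : ∀ j z y, F j (Function.update z j y) = F j z)
    (hM : ∀ᵐ z ∂Measure.pi ν, ∀ j, |f z - F j z| ≤ M)
    (hv : ∀ᵐ z ∂Measure.pi ν, ∑ j, (f z - F j z) ^ 2 ≤ v) (hs : 0 ≤ s) (hsM : s * M ≤ 1) :
    s * ∫ z, f z * Real.exp (s * f z) ∂Measure.pi ν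
      - mgf f (Measure.pi ν) s * cgf f (Measure.pi ν) s
      ≤ v * s ^ 2 * mgf f (Measure.pi ν) s := by
  have hg : Measurable fun z => Real.exp (s * f z) := (hf.const_mul s).exp
  have hu : ∀ j, Measurable fun z => Real.exp (s * F j z) := fun j => ((hF j).const_mul s).exp
  have hgb := fun z => exp_mul_mem_Icc s (hfB z)
  have hub := fun j z => exp_mul_mem_Icc s (hFB j z)
  have h := entropy_le_sum (ν := ν) (Real.exp_pos _) hg hu hgb hub
    (fun j z y => by simp [hFj j z y])
  have ig := integrable_of_mem_Icc (μ := Measure.pi ν) hg hgb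
  have iu := fun j => integrable_of_mem_Icc (μ := Measure.pi ν) (hu j) (hub j)
  have il := integrable_mul_log (μ := Measure.pi ν) hg hg (Real.exp_pos _) hgb hgb
  have ilu := fun j =>
    integrable_mul_log (μ := Measure.pi ν) hg (hu j) (Real.exp_pos _) hgb (hub j)
  have itot : ∀ j, Integrable (fun z => Real.exp (s * f z) * Real.log (Real.exp (s * f z))
      - Real.exp (s * f z) * Real.log (Real.exp (s * F j z)) - Real.exp (s * f z)
      + Real.exp (s * F j z)) (Measure.pi ν) := fun j => ((il.sub (ilu j)).sub ig).add (iu j)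
  rw [← integral_finsetSum _ fun j _ => itot j] at h
  have h2 : ∫ z, ∑ j, (Real.exp (s * f z) * Real.log (Real.exp (s * f z))
      - Real.exp (s * f z) * Real.log (Real.exp (s * F j z)) - Real.exp (s * f z)
      + Real.exp (s * F j z)) ∂Measure.pi ν
      ≤ ∫ z, v * s ^ 2 * Real.exp (s * f z) ∂Measure.pi ν := by
    refine integral_mono_ae (integrable_finsetSum _ fun j _ => itot j) (ig.const_mul _) ?_
    filter_upwards [hM, hv] with z hMz hvz
    have h3 : ∀ j, Real.exp (s * f z) * Real.log (Real.exp (s * f z))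
        - Real.exp (s * f z) * Real.log (Real.exp (s * F j z)) - Real.exp (s * f z)
        + Real.exp (s * F j z) ≤ s ^ 2 * Real.exp (s * f z) * (f z - F j z) ^ 2 := by
      intro j
      set x := -(s * (f z - F j z)) with hx
      have hx1 : |x| ≤ 1 := by
        rw [hx, abs_neg, abs_mul, abs_of_nonneg hs]
        exact (mul_le_mul_of_nonneg_left (hMz j) hs).trans hsM
      have h4 := (le_abs_self _).trans (Real.abs_exp_sub_one_sub_id_le hx1)
      have h5 : Real.exp (s * F j z) = Real.exp (s * f z) * Real.exp x := by
        rw [← Real.exp_add, hx]; ring_nf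
      have h6 := mul_le_mul_of_nonneg_left h4 (Real.exp_pos (s * f z)).le
      simp only [Real.log_exp]
      rw [h5]
      have h7 : x ^ 2 = s ^ 2 * (f z - F j z) ^ 2 := by rw [hx]; ring
      rw [h7] at h6
      rw [hx] at h6 ⊢
      linarith
    refine (Finset.sum_le_sum fun j _ => h3 j).trans ?_
    rw [← Finset.mul_sum]
    have := mul_le_mul_of_nonneg_left hvz (by positivity : 0 ≤ s ^ 2 * Real.exp (s * f z))
    linarith
  have h3 := h.trans h2
  rw [integral_const_mul] at h3
  have h4 : ∫ z, Real.exp (s * f z) * Real.log (Real.exp (s * f z)) ∂Measure.pi ν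
      = s * ∫ z, f z * Real.exp (s * f z) ∂Measure.pi ν := by
    rw [← integral_const_mul]
    congr 1; ext z; rw [Real.log_exp]; ring
  rw [h4] at h3
  exact h3

/-- Herbst's argument. -/
theorem cgf_le_of_entropy_le {α : Type*} [MeasurableSpace α] {μ : Measure α}
    [IsProbabilityMeasure μ] {f : α → ℝ} {B v s : ℝ} (hf : Measurable f) (hfB : ∀ z, |f z| ≤ B)
    (hs : 0 < s)
    (h : ∀ r, 0 < r → r ≤ s → r * ∫ z, f z * Real.exp (r * f z) ∂μ - mgf f μ r * cgf f μ r
      ≤ v * r ^ 2 * mgf f μ r) :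
    cgf f μ s ≤ s * ∫ z, f z ∂μ + v * s ^ 2 := by
  have hexp : integrableExpSet f μ = Set.univ := by
    refine Set.eq_univ_of_forall fun r => ?_
    exact integrable_of_mem_Icc (hf.const_mul r).exp fun z => exp_mul_mem_Icc r (hfB z)
  have hmem : ∀ r, r ∈ interior (integrableExpSet f μ) := by simp [hexp]
  have hderiv : ∀ r, HasDerivAt (cgf f μ)
      ((∫ z, f z * Real.exp (r * f z) ∂μ) / mgf f μ r) r := fun r => by
    rw [← deriv_cgf (hmem r)]
    exact (analyticAt_cgf (hmem r)).differentiableAt.hasDerivAt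
  have hH : ∀ r, 0 < r → HasDerivAt (fun r => cgf f μ r / r - v * r)
      ((((∫ z, f z * Real.exp (r * f z) ∂μ) / mgf f μ r) * r - cgf f μ r * 1) / r ^ 2 - v * 1)
      r := fun r hr =>
    ((hderiv r).div (hasDerivAt_id r) hr.ne').sub ((hasDerivAt_id r).const_mul v)
  -- Multiplied by r² mgf(r), the derivative is the entropy of exp(rf) minus v r² mgf(r), which is
  -- nonpositive by `h`.
  have hanti : AntitoneOn (fun r => cgf f μ r / r - v * r) (Set.Ioc 0 s) := by
    refine antitoneOn_of_deriv_nonpos (convex_Ioc 0 s)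
      (fun r hr => (hH r hr.1).continuousAt.continuousWithinAt)
      (fun r hr => ?_) fun r hr => ?_
    · rw [interior_Ioc] at hr
      exact (hH r hr.1).differentiableAt.differentiableWithinAt
    · rw [interior_Ioc] at hr
      rw [(hH r hr.1).deriv]
      have hm : 0 < mgf f μ r := mgf_pos (hexp.symm ▸ Set.mem_univ r : r ∈ integrableExpSet f μ)
      have h1 := h r hr.1 hr.2.le
      have h2 : r ^ 2 > 0 := by have := hr.1; positivity
      rw [sub_nonpos, div_le_iff₀ h2, div_mul_eq_mul_div, sub_le_iff_le_add, div_le_iff₀ hm]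
      linarith
  -- As the cgf vanishes at 0, the quotient tends to its derivative there, the mean of f.
  have hlim : Filter.Tendsto (fun r => cgf f μ r / r - v * r) (nhdsWithin 0 (Set.Ioi 0))
      (nhds (∫ z, f z ∂μ)) := by
    have h0 := hderiv 0
    rw [hasDerivAt_iff_tendsto_slope_zero] at h0
    have h1 := h0.mono_left (nhdsWithin_mono 0 (fun x hx => (ne_of_gt hx : x ≠ 0)) :
      nhdsWithin (0 : ℝ) (Set.Ioi 0) ≤ _)
    have h2 : Filter.Tendsto (fun r : ℝ => v * r) (nhdsWithin 0 (Set.Ioi 0)) (nhds (v * 0)) :=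
      ((continuous_const.mul continuous_id).tendsto 0).mono_left nhdsWithin_le_nhds
    have h3 := h1.sub h2
    simp only [zero_add, cgf_zero, sub_zero, smul_eq_mul, zero_mul, Real.exp_zero, mul_one,
      mgf_zero, div_one, mul_zero] at h3
    refine h3.congr fun r => ?_
    rw [div_eq_inv_mul]
  have hfin : cgf f μ s / s - v * s ≤ ∫ z, f z ∂μ := by
    refine ge_of_tendsto hlim ?_
    filter_upwards [Ioc_mem_nhdsGT hs] with r hr
    exact hanti hr ⟨hs, le_rfl⟩ hr.2
  rw [sub_le_iff_le_add, div_le_iff₀ hs] at hfin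
  linarith

/-- A function of independent variables whose differences with functions not depending on one of
the variables have bounded sum of squares is sub-Gaussian, in the range where each of these
differences is small. -/
theorem measureReal_pi_ge_le_exp {f : (∀ i, E i) → ℝ} {F : ι → (∀ i, E i) → ℝ} {B M v t : ℝ}
    (hf : Measurable f) (hF : ∀ j, Measurable (F j)) (hfB : ∀ z, |f z| ≤ B)
    (hFB : ∀ j z, |F j z| ≤ B) (hFj : ∀ j z y, F j (Function.update z j y) = F j z)
    (hM : ∀ᵐ z ∂Measure.pi ν, ∀ j, |f z - F j z| ≤ M)
    (hv : ∀ᵐ z ∂Measure.pi ν, ∑ j, (f z - F j z) ^ 2 ≤ v) (hM0 : 0 ≤ M) (hv0 : 0 < v)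
    (ht : 0 < t) (htM : t * M ≤ 2 * v) :
    (Measure.pi ν).real {z | t ≤ f z - ∫ z', f z' ∂Measure.pi ν}
      ≤ Real.exp (-(t ^ 2 / (4 * v))) := by
  -- The minimiser of -st + vs²; `htM` says exactly that it is admissible, sM ≤ 1.
  set s := t / (2 * v) with hs
  have hs0 : 0 < s := by positivity
  have hsM : s * M ≤ 1 := by
    rw [hs, div_mul_eq_mul_div, div_le_one (by positivity)]; exact htM
  have h1 := cgf_le_of_entropy_le (μ := Measure.pi ν) (v := v) hf hfB hs0 fun r hr hrs =>
    entropy_exp_le hf hF hfB hFB hFj hM hv hr.le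
      ((mul_le_mul_of_nonneg_right hrs hM0).trans hsM)
  have h2 := measure_ge_le_exp_cgf (μ := Measure.pi ν) (X := f)
    (t + ∫ z', f z' ∂Measure.pi ν) hs0.le
    (integrable_of_mem_Icc (hf.const_mul s).exp fun z => exp_mul_mem_Icc s (hfB z))
  have h3 : {z | t ≤ f z - ∫ z', f z' ∂Measure.pi ν}
      = {z | t + ∫ z', f z' ∂Measure.pi ν ≤ f z} := by
    ext z; simp only [Set.mem_ofPred_eq]; exact le_sub_iff_add_le
  rw [h3]
  refine h2.trans (Real.exp_le_exp.2 ?_)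
  have h4 : -(t ^ 2 / (4 * v)) = -s * t + v * s ^ 2 := by rw [hs]; field_simp; ring
  rw [h4]
  linarith

end Concentration
-- Geometry of nearest neighbours and Stone's lemma.
namespace KNN

theorem mem_neighbors {d n : ℕ} {k : ℕ} {x : Fin n → EuclideanSpace ℝ (Fin d)}
    {e : Finset (Fin n)} {a : EuclideanSpace ℝ (Fin d)} {j : Fin n} :
    j ∈ neighbors k x e a ↔
      j ∈ e ∧ (e.filter fun l => dist a (x l) < dist a (x j)).card < k := by
  simp [neighbors]

/-- With u, w the directions of x, y, write y - x = ‖x‖(w - u) + (‖y‖ - ‖x‖)w and use the triangle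
inequality. -/
theorem norm_sub_lt_of_dist_dir_lt {V : Type*} [NormedAddCommGroup V] [NormedSpace ℝ V]
    {x y : V} (hx : x ≠ 0) (hy : y ≠ 0) (hxy : ‖x‖ ≤ ‖y‖)
    (h : dist (‖x‖⁻¹ • x) (‖y‖⁻¹ • y) < 1) : ‖y - x‖ < ‖y‖ := by
  have hx' : 0 < ‖x‖ := norm_pos_iff.2 hx
  have hy' : 0 < ‖y‖ := norm_pos_iff.2 hy
  have e : y - x = ‖x‖ • (‖y‖⁻¹ • y - ‖x‖⁻¹ • x) + (‖y‖ - ‖x‖) • (‖y‖⁻¹ • y) := by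
    rw [smul_sub, sub_smul, smul_inv_smul₀ hx'.ne', smul_inv_smul₀ hy'.ne']
    abel
  have hu : ‖‖y‖⁻¹ • y‖ = 1 := by
    rw [norm_smul, norm_inv, norm_norm, inv_mul_cancel₀ hy'.ne']
  rw [dist_comm, dist_eq_norm] at h
  calc ‖y - x‖ ≤ ‖‖x‖ • (‖y‖⁻¹ • y - ‖x‖⁻¹ • x)‖ + ‖(‖y‖ - ‖x‖) • (‖y‖⁻¹ • y)‖ := by
        conv_lhs => rw [e]
        exact norm_add_le _ _
    _ = ‖x‖ * ‖‖y‖⁻¹ • y - ‖x‖⁻¹ • x‖ + (‖y‖ - ‖x‖) := by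
        rw [norm_smul, norm_norm, norm_smul, hu, mul_one, Real.norm_of_nonneg (sub_nonneg.2 hxy)]
    _ < ‖y‖ := by
        have := mul_lt_mul_of_pos_left h hx'
        linarith

theorem exists_finset_sphere_subset_balls (V : Type*) [NormedAddCommGroup V] [ProperSpace V] :
    ∃ C : Finset V, ∀ u : V, ‖u‖ = 1 → ∃ c ∈ C, dist u c < 1 / 2 := by
  obtain ⟨t, -, ht, hc⟩ := (isCompact_sphere (0 : V) 1).finite_cover_balls
    (show (0 : ℝ) < 1 / 2 by norm_num)
  refine ⟨ht.toFinset, fun u hu => ?_⟩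
  have := hc (show u ∈ Metric.sphere (0 : V) 1 by simpa using hu)
  simpa using this

/-- The points of a family having `x j` among their `k` nearest neighbours are at most `k` if each
of them is closer to those less distant from `x j` than to `x j`. -/
theorem card_le_of_mem_neighbors {d n k : ℕ} {x : Fin n → EuclideanSpace ℝ (Fin d)} {j : Fin n}
    {T : Finset (Fin n)} (hT : ∀ i ∈ T, j ∈ neighbors k x (Finset.univ.erase i) (x i))
    (h : ∀ i ∈ T, ∀ i' ∈ T, i ≠ i' → dist (x i) (x j) ≤ dist (x i') (x j) →
      dist (x i') (x i) < dist (x i') (x j)) : T.card ≤ k := by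
  rcases T.eq_empty_or_nonempty with rfl | hne
  · simp
  -- For the member m farthest from x j, all other members are strictly closer to x m than x j is;
  -- as x j is a k-neighbour of x m, there are fewer than k of them.
  obtain ⟨m, hm, hmax⟩ := T.exists_max_image (fun i => dist (x i) (x j)) hne
  have h1 := (mem_neighbors.1 (hT m hm)).2
  have h2 : T.erase m ⊆ (Finset.univ.erase m).filter
      fun l => dist (x m) (x l) < dist (x m) (x j) := by
    intro i hi
    rw [Finset.mem_erase] at hi
    simp only [Finset.mem_filter, Finset.mem_erase, Finset.mem_univ, and_true]
    exact ⟨hi.1, h i hi.2 m hm hi.1 (hmax i hi.2)⟩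
  have h3 := Finset.card_le_card h2
  rw [Finset.card_erase_of_mem hm] at h3
  omega

/-- Stone's lemma. -/
theorem exists_isStoneConstant (d : ℕ) : ∃ γ, IsStoneConstant d γ := by
  classical
  obtain ⟨C, hC⟩ := exists_finset_sphere_subset_balls (EuclideanSpace ℝ (Fin d))
  -- One class of at most k points per ball covering the unit sphere of directions, plus one for
  -- points equal to x j. Radius 1/2 makes two directions in a ball less than 1 apart.
  refine ⟨(C.card + 1 : ℕ), fun n k x hx j => ?_⟩
  set S := Finset.univ.filter fun i : Fin n =>
    i ≠ j ∧ j ∈ neighbors k x (Finset.univ.erase i) (x i) with hS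
  set dir : Fin n → EuclideanSpace ℝ (Fin d) := fun i => ‖x i - x j‖⁻¹ • (x i - x j)
  have hSm : ∀ {i}, i ∈ S → i ≠ j ∧ j ∈ neighbors k x (Finset.univ.erase i) (x i) := by
    intro i hi; simpa [hS] using hi
  have h0 : (S.filter fun i => x i = x j).card ≤ k := by
    refine card_le_of_mem_neighbors (j := j) (x := x)
      (fun i hi => (hSm (Finset.mem_filter.1 hi).1).2) fun i hi i' hi' hii' _ => ?_
    -- Two distinct indices in this class would both be at distance 0 from x j, a tie.
    rw [Finset.mem_filter] at hi hi'
    exact absurd (by rw [hi.2, hi'.2])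
      (hx j i i' (hSm hi.1).1.symm (hSm hi'.1).1.symm hii')
  have h1 : ∀ c ∈ C, (S.filter fun i => x i ≠ x j ∧ dist (dir i) c < 1 / 2).card ≤ k := by
    intro c _
    refine card_le_of_mem_neighbors (j := j) (x := x)
      (fun i hi => (hSm (Finset.mem_filter.1 hi).1).2) fun i hi i' hi' _ hd => ?_
    rw [Finset.mem_filter] at hi hi'
    rw [dist_eq_norm, dist_eq_norm] at hd ⊢
    have h := norm_sub_lt_of_dist_dir_lt (sub_ne_zero.2 hi.2.1) (sub_ne_zero.2 hi'.2.1) hd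
      ((dist_triangle_right (dir i) (dir i') c).trans_lt (by linarith [hi.2.2, hi'.2.2]))
    rw [sub_sub_sub_cancel_right] at h
    exact h
  have h2 : S ⊆ (S.filter fun i => x i = x j) ∪
      C.biUnion fun c => S.filter fun i => x i ≠ x j ∧ dist (dir i) c < 1 / 2 := by
    intro i hi
    by_cases hij : x i = x j
    · exact Finset.mem_union_left _ (Finset.mem_filter.2 ⟨hi, hij⟩)
    · have hn : ‖dir i‖ = 1 := by
        have : ‖x i - x j‖ ≠ 0 := norm_ne_zero_iff.2 (sub_ne_zero.2 hij)
        simp only [dir]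
        rw [norm_smul, norm_inv, norm_norm, inv_mul_cancel₀ this]
      obtain ⟨c, hc, hcd⟩ := hC _ hn
      exact Finset.mem_union_right _
        (Finset.mem_biUnion.2 ⟨c, hc, Finset.mem_filter.2 ⟨hi, hij, hcd⟩⟩)
  have h3 : S.card ≤ k * (C.card + 1) := by
    refine (Finset.card_le_card h2).trans ((Finset.card_union_le _ _).trans ?_)
    have := Finset.card_biUnion_le_card_mul C _ k h1
    linarith
  exact_mod_cast h3

/-- The infimum is attained, since each instance of the condition is a closed lower bound on γ; k =
0 does not constrain γ and is treated apart. -/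
theorem isStoneConstant_stoneConstant (d : ℕ) : IsStoneConstant d (stoneConstant d) := by
  intro n k x hx j
  rcases Nat.eq_zero_or_pos k with rfl | hk
  · obtain ⟨γ, hγ⟩ := exists_isStoneConstant d
    simpa using hγ n 0 x hx j
  · have hk' : (0 : ℝ) < k := by exact_mod_cast hk
    rw [mul_comm, ← div_le_iff₀ hk']
    refine le_csInf (exists_isStoneConstant d) fun γ hγ => ?_
    rw [div_le_iff₀ hk', mul_comm]
    exact hγ n k x hx j

theorem stoneConstant_nonneg (d : ℕ) : 0 ≤ stoneConstant d := by
  have h := isStoneConstant_stoneConstant d 1 1 (fun _ => 0)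
    (fun i j _ hij => absurd (Subsingleton.elim i j) hij) 0
  have h' := (Nat.cast_nonneg (α := ℝ) _).trans h
  simpa using h'

theorem neighbors_map {d m n : ℕ} (k : ℕ) (x : Fin n → EuclideanSpace ℝ (Fin d))
    (φ : Fin m ↪ Fin n) (e : Finset (Fin m)) (a : EuclideanSpace ℝ (Fin d)) :
    neighbors k x (e.map φ) a = (neighbors k (x ∘ φ) e a).map φ := by
  simp only [neighbors, Finset.filter_map, Finset.card_map]
  rfl

/-- Stone's lemma for a subfamily of a family of points. -/
theorem card_filter_mem_neighbors_le {d n : ℕ} (k : ℕ) {x : Fin n → EuclideanSpace ℝ (Fin d)}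
    (hx : NoDistanceTies x) (s : Finset (Fin n)) {j : Fin n} (hj : j ∈ s) :
    (((s.filter fun i => i ≠ j ∧ j ∈ neighbors k x (s.erase i) (x i)).card : ℕ) : ℝ)
      ≤ k * stoneConstant d := by
  classical
  obtain ⟨m, φ, rfl⟩ : ∃ (m : ℕ) (φ : Fin m ↪ Fin n), Finset.univ.map φ = s :=
    ⟨s.card, (s.orderEmbOfFin rfl).toEmbedding, Finset.map_orderEmbOfFin_univ s rfl⟩
  obtain ⟨j', -, rfl⟩ := Finset.mem_map.1 hj
  have hx' : NoDistanceTies (x ∘ φ) := fun i j l hij hil hjl =>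
    hx _ _ _ (φ.injective.ne hij) (φ.injective.ne hil) (φ.injective.ne hjl)
  have h := isStoneConstant_stoneConstant d m k (x ∘ φ) hx' j'
  have he : ((Finset.univ.map φ).filter fun i =>
        i ≠ φ j' ∧ φ j' ∈ neighbors k x ((Finset.univ.map φ).erase i) (x i))
      = (Finset.univ.filter fun i => i ≠ j' ∧
        j' ∈ neighbors k (x ∘ φ) (Finset.univ.erase i) ((x ∘ φ) i)).map φ := by
    rw [Finset.filter_map]
    congr 1
    refine Finset.filter_congr fun i _ => ?_
    simp only [Function.comp_apply]
    rw [← Finset.map_erase, neighbors_map, Finset.mem_map', φ.injective.ne_iff]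
  rw [he, Finset.card_map]
  exact h

/-- Deleting j could only promote some l farther than j. But if fewer than k points other than j are
closer than l, then fewer than k are closer than j, so j was a neighbour. -/
theorem neighbors_erase {d n k : ℕ} {x : Fin n → EuclideanSpace ℝ (Fin d)} {e : Finset (Fin n)}
    {a : EuclideanSpace ℝ (Fin d)} {j : Fin n} (hj : j ∉ neighbors k x e a) :
    neighbors k x (e.erase j) a = neighbors k x e a := by
  ext l
  by_cases hlj : l = j
  · subst hlj; simp [hj, mem_neighbors]
  rw [mem_neighbors, mem_neighbors, Finset.mem_erase, Finset.filter_erase]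
  constructor
  · rintro ⟨⟨-, hl⟩, hc⟩
    refine ⟨hl, ?_⟩
    by_cases hjl : j ∈ e ∧ dist a (x j) < dist a (x l)
    · refine absurd (mem_neighbors.2 ⟨hjl.1, lt_of_le_of_lt (Finset.card_le_card ?_) hc⟩) hj
      intro i hi
      rw [Finset.mem_filter] at hi
      refine Finset.mem_erase.2 ⟨?_, Finset.mem_filter.2 ⟨hi.1, hi.2.trans hjl.2⟩⟩
      rintro rfl
      exact lt_irrefl _ hi.2
    · rwa [Finset.erase_eq_of_notMem (by simpa using hjl)] at hc
  · rintro ⟨hl, hc⟩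
    exact ⟨⟨hlj, hl⟩, (Finset.card_le_card (Finset.erase_subset _ _)).trans_lt hc⟩

theorem card_neighbors_le {d n k : ℕ} {x : Fin n → EuclideanSpace ℝ (Fin d)} {e : Finset (Fin n)}
    {a : EuclideanSpace ℝ (Fin d)}
    (h : ∀ j ∈ e, ∀ l ∈ e, j ≠ l → dist a (x j) ≠ dist a (x l)) :
    (neighbors k x e a).card ≤ k := by
  rcases (neighbors k x e a).eq_empty_or_nonempty with h0 | hne
  · simp [h0]
  obtain ⟨m, hm, hmax⟩ := Finset.exists_max_image _ (fun i => dist a (x i)) hne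
  have h1 := mem_neighbors.1 hm
  have h2 : (neighbors k x e a).erase m ⊆ e.filter fun l => dist a (x l) < dist a (x m) := by
    intro i hi
    rw [Finset.mem_erase] at hi
    have hie := (mem_neighbors.1 hi.2).1
    exact Finset.mem_filter.2 ⟨hie, (hmax i hi.2).lt_of_ne (h i hie m h1.1 hi.1)⟩
  have h3 := Finset.card_le_card h2
  rw [Finset.card_erase_of_mem hm] at h3
  omega

end KNN
-- Effect of deleting one observation.
namespace KNN

/-- The number of pairs of a training set `e` of `n - p` indices and an index `i` outside it such
that `x j` is among the `k` nearest neighbours of `x i` in the training set. -/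
noncomputable def neighborCount {d n : ℕ} (p k : ℕ) (x : Fin n → EuclideanSpace ℝ (Fin d))
    (j : Fin n) : ℕ :=
  ∑ e ∈ (Finset.univ : Finset (Fin n)).powersetCard (n - p),
    (eᶜ.filter fun i => j ∈ neighbors k x e (x i)).card

/-- The leave-`p`-out estimator computed without the observation `j`. -/
noncomputable def leavePOutErase {d n : ℕ} (p k : ℕ) (j : Fin n)
    (z : Fin n → EuclideanSpace ℝ (Fin d) × Fin 2) : ℝ :=
  ((n.choose p : ℕ) : ℝ)⁻¹ * ∑ e ∈ (Finset.univ : Finset (Fin n)).powersetCard (n - p),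
    (1 / (p : ℝ)) * ∑ i ∈ eᶜ.erase j,
      if classifier k z (e.erase j) (z i).1 ≠ (z i).2 then 1 else 0

theorem classifier_erase {d n k : ℕ} {z : Fin n → EuclideanSpace ℝ (Fin d) × Fin 2}
    {e : Finset (Fin n)} {a : EuclideanSpace ℝ (Fin d)} {j : Fin n}
    (hj : j ∉ neighbors k (fun i => (z i).1) e a) :
    classifier k z (e.erase j) a = classifier k z e a := by
  rw [classifier, classifier, neighbors_erase hj]

theorem card_powersetCard_filter_mem_compl {n p : ℕ} (hp : 1 ≤ p) (hpn : p ≤ n) (j : Fin n) :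
    (((Finset.univ : Finset (Fin n)).powersetCard (n - p)).filter fun e => j ∈ eᶜ).card
      = (n - 1).choose (p - 1) := by
  have : (((Finset.univ : Finset (Fin n)).powersetCard (n - p)).filter fun e => j ∈ eᶜ)
      = (Finset.univ.erase j).powersetCard (n - p) := by
    ext e
    simp only [Finset.mem_filter, Finset.mem_powersetCard, Finset.subset_univ, true_and,
      Finset.mem_compl, Finset.subset_erase]
    tauto
  rw [this, Finset.card_powersetCard, Finset.card_erase_of_mem (Finset.mem_univ j),
    Finset.card_univ, Fintype.card_fin]
  exact Nat.choose_symm_of_eq_add (by omega)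

theorem card_powersetCard_filter_mem_le {n p : ℕ} (hp : 1 ≤ p) (hpn : p ≤ n) (j : Fin n) :
    (((Finset.univ : Finset (Fin n)).powersetCard (n - p + 1)).filter fun s => j ∈ s).card
      ≤ (n - 1).choose (p - 1) := by
  rw [← card_powersetCard_filter_mem_compl hp hpn j]
  refine Finset.card_le_card_of_injOn (fun s => s.erase j) (fun s hs => ?_) ?_
  · simp only [Finset.coe_filter, Finset.mem_powersetCard, Finset.subset_univ, true_and,
      Set.mem_ofPred_eq] at hs ⊢
    refine ⟨?_, by simp⟩
    rw [Finset.card_erase_of_mem hs.2, hs.1]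
    rfl
  · intro s hs s' hs' h
    simp only [Finset.coe_filter, Set.mem_ofPred_eq] at hs hs'
    rw [← Finset.insert_erase hs.2, ← Finset.insert_erase hs'.2, show s.erase j = s'.erase j from h]

theorem choose_mul_eq {n p : ℕ} (hp : 1 ≤ p) (hpn : p ≤ n) :
    n.choose p * p = n * (n - 1).choose (p - 1) := by
  obtain ⟨p, rfl⟩ := Nat.exists_eq_add_of_le' hp
  obtain ⟨n, rfl⟩ := Nat.exists_eq_add_of_le' (hp.trans hpn)
  exact (Nat.add_one_mul_choose_eq n p).symm

theorem neighborCount_le {d n p k : ℕ} (hp : 1 ≤ p) (hpn : p ≤ n)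
    {x : Fin n → EuclideanSpace ℝ (Fin d)} (hx : NoDistanceTies x) (j : Fin n) :
    (neighborCount p k x j : ℝ) ≤ (k * stoneConstant d) * ((n - 1).choose (p - 1) : ℕ) := by
  classical
  set P := ((Finset.univ : Finset (Fin n)).powersetCard (n - p + 1)).filter fun s => j ∈ s with hP
  have h1 : neighborCount p k x j ≤ ∑ s ∈ P,
      (s.filter fun i => i ≠ j ∧ j ∈ neighbors k x (s.erase i) (x i)).card := by
    rw [neighborCount, ← Finset.card_sigma, ← Finset.card_sigma]
    -- Adding the test index to its training set gives a family s of n - p + 1 points containing j,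
    -- in which x i looks for neighbours among the others: the setting of Stone's lemma.
    refine Finset.card_le_card_of_injOn (fun q => ⟨insert q.2 q.1, q.2⟩) ?_ ?_
    · rintro ⟨e, i⟩ hq
      simp only [Finset.coe_sigma, Set.mem_sigma_iff, Finset.mem_coe, Finset.mem_powersetCard,
        Finset.subset_univ, true_and, Finset.mem_filter, Finset.mem_compl, hP] at hq ⊢
      obtain ⟨he, hi, hj⟩ := hq
      have hje := (mem_neighbors.1 hj).1
      refine ⟨⟨by rw [Finset.card_insert_of_notMem hi, he], Finset.mem_insert_of_mem hje⟩,
        Finset.mem_insert_self _ _, ?_, by rwa [Finset.erase_insert hi]⟩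
      rintro rfl
      exact hi hje
    · rintro ⟨e, i⟩ hq ⟨e', i'⟩ hq' h
      simp only [Finset.coe_sigma, Set.mem_sigma_iff, Finset.mem_coe, Finset.mem_filter,
        Finset.mem_compl] at hq hq'
      simp only [Sigma.mk.injEq, heq_eq_eq] at h
      obtain ⟨h1, rfl⟩ := h
      rw [← Finset.erase_insert hq.2.1, h1, Finset.erase_insert hq'.2.1]
  have h2 : (∑ s ∈ P, (((s.filter fun i =>
      i ≠ j ∧ j ∈ neighbors k x (s.erase i) (x i)).card : ℕ) : ℝ))
      ≤ P.card • (k * stoneConstant d) :=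
    Finset.sum_le_card_nsmul _ _ _ fun s hs =>
      card_filter_mem_neighbors_le k hx s (Finset.mem_filter.1 hs).2
  have h3 : (P.card : ℝ) ≤ ((n - 1).choose (p - 1) : ℕ) :=
    Nat.cast_le.2 (card_powersetCard_filter_mem_le hp hpn j)
  calc (neighborCount p k x j : ℝ) ≤ _ := by exact_mod_cast h1
    _ ≤ _ := h2
    _ ≤ _ := by
      rw [nsmul_eq_mul, mul_comm]
      exact mul_le_mul_of_nonneg_left h3
        (mul_nonneg (Nat.cast_nonneg k) (stoneConstant_nonneg d))

/-- Double counting: there are C(n, p) p = n C(n-1, p-1) pairs (e, i), each with at most k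
neighbours j. -/
theorem sum_neighborCount_le {d n p k : ℕ} (hp : 1 ≤ p) (hpn : p ≤ n)
    {x : Fin n → EuclideanSpace ℝ (Fin d)} (hx : NoDistanceTies x) :
    ∑ j, neighborCount p k x j ≤ n * (n - 1).choose (p - 1) * k := by
  classical
  unfold neighborCount
  rw [Finset.sum_comm]
  have h : ∀ e ∈ (Finset.univ : Finset (Fin n)).powersetCard (n - p),
      ∑ j, (eᶜ.filter fun i => j ∈ neighbors k x e (x i)).card ≤ p * k := by
    intro e he
    have hc : eᶜ.card = p := by
      rw [Finset.card_compl, (Finset.mem_powersetCard.1 he).2, Fintype.card_fin]; omega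
    simp only [Finset.card_filter]
    rw [Finset.sum_comm, ← hc]
    refine Finset.sum_le_card_nsmul _ _ _ fun i hi => ?_
    rw [← Finset.card_filter, Finset.filter_mem_eq_inter, Finset.univ_inter]
    refine card_neighbors_le fun j hj l hl hjl => hx i j l ?_ ?_ hjl
    · rintro rfl; exact (Finset.mem_compl.1 hi) hj
    · rintro rfl; exact (Finset.mem_compl.1 hi) hl
  refine (Finset.sum_le_card_nsmul _ _ _ h).trans ?_
  rw [Finset.card_powersetCard, Finset.card_univ, Fintype.card_fin, Nat.choose_symm hpn,
    smul_eq_mul, ← mul_assoc, choose_mul_eq hp hpn]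

theorem abs_leavePOut_sub_leavePOutErase_le {d n p k : ℕ} (hp : 1 ≤ p) (hpn : p ≤ n)
    (z : Fin n → EuclideanSpace ℝ (Fin d) × Fin 2) (j : Fin n) :
    |leavePOut p k z - leavePOutErase p k j z| ≤
      (((n - 1).choose (p - 1) : ℕ) + neighborCount p k (fun i => (z i).1) j : ℝ)
        / (n * ((n - 1).choose (p - 1) : ℕ)) := by
  classical
  set x := fun i => (z i).1 with hx
  set P := (Finset.univ : Finset (Fin n)).powersetCard (n - p) with hP
  have h1 : ∀ e ∈ P, |(∑ i ∈ eᶜ, if classifier k z e (z i).1 ≠ (z i).2 then (1 : ℝ) else 0)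
      - ∑ i ∈ eᶜ.erase j, if classifier k z (e.erase j) (z i).1 ≠ (z i).2 then (1 : ℝ) else 0|
      ≤ (if j ∈ eᶜ then 1 else 0)
        + ((eᶜ.filter fun i => j ∈ neighbors k x e (x i)).card : ℝ) := by
    intro e _
    have h2 : ∑ i ∈ eᶜ.erase j,
        (if classifier k z (e.erase j) (z i).1 ≠ (z i).2 then (1 : ℝ) else 0)
        = ∑ i ∈ eᶜ, if i ≠ j then
          (if classifier k z (e.erase j) (z i).1 ≠ (z i).2 then (1 : ℝ) else 0) else 0 := by
      rw [← Finset.filter_ne', Finset.sum_filter]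
    have h3 : (if j ∈ eᶜ then (1 : ℝ) else 0) = ∑ i ∈ eᶜ, if i = j then (1 : ℝ) else 0 := by
      rw [Finset.sum_ite_eq']
    have h4 : ((eᶜ.filter fun i => j ∈ neighbors k x e (x i)).card : ℝ)
        = ∑ i ∈ eᶜ, if j ∈ neighbors k x e (x i) then (1 : ℝ) else 0 := by
      rw [Finset.card_filter]; push_cast; rfl
    rw [h2, h3, h4, ← Finset.sum_sub_distrib, ← Finset.sum_add_distrib]
    refine (Finset.abs_sum_le_sum_abs _ _).trans (Finset.sum_le_sum fun i _ => ?_)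
    by_cases hij : i = j
    · simp only [hij, ne_eq, not_true_eq_false, if_true, if_false, sub_zero]
      split_ifs <;> norm_num
    · by_cases hj : j ∈ neighbors k x e (x i)
      · simp only [hij, hj, ne_eq, not_false_eq_true, if_true, if_false]
        split_ifs <;> norm_num
      · simp only [hx] at hj ⊢
        rw [classifier_erase hj]
        simp [hij, hj]
  have hC : (0 : ℝ) < (n.choose p : ℕ) := by exact_mod_cast Nat.choose_pos hpn
  have hp' : (0 : ℝ) < p := by exact_mod_cast hp
  have h5 : (∑ e ∈ P, if j ∈ eᶜ then (1 : ℝ) else 0) = ((n - 1).choose (p - 1) : ℕ) := by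
    rw [← card_powersetCard_filter_mem_compl hp hpn j, Finset.card_filter]; push_cast; rfl
  have hN : (n : ℝ) * ((n - 1).choose (p - 1) : ℕ) = (n.choose p : ℕ) * p := by
    exact_mod_cast (choose_mul_eq hp hpn).symm
  have h6 : leavePOut p k z - leavePOutErase p k j z
      = (∑ e ∈ P, ((∑ i ∈ eᶜ, if classifier k z e (z i).1 ≠ (z i).2 then (1 : ℝ) else 0)
        - ∑ i ∈ eᶜ.erase j, if classifier k z (e.erase j) (z i).1 ≠ (z i).2 then (1 : ℝ) else 0))
        / ((n.choose p : ℕ) * p) := by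
    rw [leavePOut, leavePOutErase, ← Finset.mul_sum, ← Finset.mul_sum, Finset.sum_sub_distrib]
    field_simp
    rfl
  rw [h6, hN, abs_div, abs_of_pos (mul_pos hC hp'), neighborCount, ← h5]
  push_cast
  rw [← Finset.sum_add_distrib]
  exact div_le_div_of_nonneg_right
    ((Finset.abs_sum_le_sum_abs _ _).trans (Finset.sum_le_sum h1)) (mul_pos hC hp').le

theorem abs_leavePOut_sub_le {d n p k : ℕ} (hp : 1 ≤ p) (hpn : p ≤ n)
    {z : Fin n → EuclideanSpace ℝ (Fin d) × Fin 2} (hz : NoDistanceTies fun i => (z i).1)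
    (j : Fin n) :
    |leavePOut p k z - leavePOutErase p k j z| ≤ (1 + stoneConstant d * k) / n := by
  have hn : (0 : ℝ) < n := by exact_mod_cast hp.trans hpn
  have hD : (0 : ℝ) < ((n - 1).choose (p - 1) : ℕ) := by
    exact_mod_cast Nat.choose_pos (by omega)
  refine (abs_leavePOut_sub_leavePOutErase_le hp hpn z j).trans ?_
  rw [div_le_div_iff₀ (by positivity) hn]
  have := mul_le_mul_of_nonneg_right (neighborCount_le (k := k) hp hpn hz j) hn.le
  linarith

theorem sum_sq_leavePOut_sub_le {d n p k : ℕ} (hp : 1 ≤ p) (hk : 1 ≤ k) (hpn : p ≤ n)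
    {z : Fin n → EuclideanSpace ℝ (Fin d) × Fin 2} (hz : NoDistanceTies fun i => (z i).1) :
    ∑ j, (leavePOut p k z - leavePOutErase p k j z) ^ 2
      ≤ (k : ℝ) ^ 2 * (3 + stoneConstant d) / n := by
  have hn : (0 : ℝ) < n := by exact_mod_cast hp.trans hpn
  set D : ℝ := (((n - 1).choose (p - 1) : ℕ) : ℝ) with hDdef
  have hD : 0 < D := by
    rw [hDdef]
    exact_mod_cast Nat.choose_pos (by omega)
  set γ := stoneConstant d
  have hγ : 0 ≤ γ := stoneConstant_nonneg d
  have hk' : (1 : ℝ) ≤ k := by exact_mod_cast hk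
  set A : Fin n → ℝ := fun j => neighborCount p k (fun i => (z i).1) j with hA
  have hA0 : ∀ j, 0 ≤ A j := fun j => Nat.cast_nonneg _
  have hA1 : ∀ j, A j ≤ k * γ * D := fun j => neighborCount_le hp hpn hz j
  have hA2 : ∑ j, A j ≤ n * D * k := by
    simp only [hDdef, hA]
    exact_mod_cast sum_neighborCount_le hp hpn hz
  have h1 : ∀ j, (leavePOut p k z - leavePOutErase p k j z) ^ 2
      ≤ (D ^ 2 + (2 * D + k * γ * D) * A j) / (n * D) ^ 2 := by
    intro j
    have h2 := abs_leavePOut_sub_leavePOutErase_le (k := k) hp hpn z j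
    rw [← sq_abs]
    refine (pow_le_pow_left₀ (abs_nonneg _) h2 2).trans ?_
    rw [div_pow]
    refine div_le_div_of_nonneg_right ?_ (by positivity)
    -- Only one factor of A_j² is bounded pointwise; the other is kept for the sum `hA2`, which
    -- saves a factor k.
    have h3 := mul_le_mul_of_nonneg_right (hA1 j) (hA0 j)
    change (D + A j) ^ 2 ≤ _
    nlinarith
  refine (Finset.sum_le_sum fun j _ => h1 j).trans ?_
  rw [← Finset.sum_div, Finset.sum_add_distrib, ← Finset.mul_sum, Finset.sum_const,
    Finset.card_univ, Fintype.card_fin, nsmul_eq_mul, div_le_div_iff₀ (by positivity) hn]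
  have h4 : (2 * D + k * γ * D) * ∑ j, A j ≤ (2 * D + k * γ * D) * (n * D * k) :=
    mul_le_mul_of_nonneg_left hA2 (by positivity)
  have h5 : 1 + 2 * (k : ℝ) ≤ 3 * k ^ 2 := by nlinarith
  calc _ ≤ (n * D ^ 2 + (2 * D + k * γ * D) * (n * D * k)) * n :=
        mul_le_mul_of_nonneg_right (by linarith) hn.le
    _ = (1 + 2 * k + γ * k ^ 2) * (n * D) ^ 2 := by ring
    _ ≤ _ := mul_le_mul_of_nonneg_right (by linarith) (by positivity)

end KNN
-- Measurability, range and tail bounds of the estimator.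
namespace KNN

theorem measurableSet_noDistanceTies {d n : ℕ} :
    MeasurableSet {z : Fin n → EuclideanSpace ℝ (Fin d) × Fin 2 |
      NoDistanceTies fun i => (z i).1} := by
  have h : {z : Fin n → EuclideanSpace ℝ (Fin d) × Fin 2 | NoDistanceTies fun i => (z i).1}
      = ⋂ (i : Fin n) (j : Fin n) (l : Fin n) (_ : i ≠ j) (_ : i ≠ l) (_ : j ≠ l),
        {z | dist (z i).1 (z j).1 = dist (z i).1 (z l).1}ᶜ := by
    ext z
    simp [NoDistanceTies]
  rw [h]
  refine MeasurableSet.iInter fun i => MeasurableSet.iInter fun j => MeasurableSet.iInter fun l =>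
    MeasurableSet.iInter fun _ => MeasurableSet.iInter fun _ => MeasurableSet.iInter fun _ =>
    (measurableSet_eq_fun ?_ ?_).compl <;> fun_prop

theorem measurable_classifier {d n k : ℕ} (e : Finset (Fin n)) (i : Fin n) :
    Measurable fun z : Fin n → EuclideanSpace ℝ (Fin d) × Fin 2 => classifier k z e (z i).1 := by
  -- The neighbour set varies with z; indicators over the fixed set e make measurability visible.
  have hsum : ∀ z : Fin n → EuclideanSpace ℝ (Fin d) × Fin 2,
      ∑ j ∈ neighbors k (fun i => (z i).1) e (z i).1, (((z j).2 : ℕ) : ℝ)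
      = ∑ j ∈ e, if (∑ l ∈ e, if dist (z i).1 (z l).1 < dist (z i).1 (z j).1 then 1 else 0) < k
        then (((z j).2 : ℕ) : ℝ) else 0 := fun z => by
    simp only [neighbors, Finset.sum_filter, Finset.card_filter]
  unfold classifier
  simp only [hsum]
  refine Measurable.ite (measurableSet_lt measurable_const (Measurable.const_mul
    (Finset.measurable_fun_sum _ fun j _ => Measurable.ite (measurableSet_lt
      (Finset.measurable_fun_sum _ fun l _ => Measurable.ite (measurableSet_lt ?_ ?_)
        measurable_const measurable_const) measurable_const) ?_ measurable_const) _))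
    measurable_const measurable_const
  · fun_prop
  · fun_prop
  · exact (measurable_of_finite fun y : Fin 2 => ((y : ℕ) : ℝ)).comp
      (measurable_snd.comp (measurable_pi_apply j))

theorem measurable_error {d n k : ℕ} (e : Finset (Fin n)) (i : Fin n) :
    Measurable fun z : Fin n → EuclideanSpace ℝ (Fin d) × Fin 2 =>
      if classifier k z e (z i).1 ≠ (z i).2 then (1 : ℝ) else 0 :=
  Measurable.ite (measurableSet_eq_fun (measurable_classifier e i)
    (measurable_snd.comp (measurable_pi_apply i))).compl measurable_const measurable_const

theorem measurable_leavePOut {d n : ℕ} (p k : ℕ) :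
    Measurable (leavePOut p k : (Fin n → EuclideanSpace ℝ (Fin d) × Fin 2) → ℝ) :=
  (Finset.measurable_fun_sum _ fun e _ =>
    (Finset.measurable_fun_sum _ fun i _ => measurable_error e i).const_mul _).const_mul _

theorem measurable_leavePOutErase {d n : ℕ} (p k : ℕ) (j : Fin n) :
    Measurable (leavePOutErase p k j : (Fin n → EuclideanSpace ℝ (Fin d) × Fin 2) → ℝ) :=
  (Finset.measurable_fun_sum _ fun e _ =>
    (Finset.measurable_fun_sum _ fun i _ => measurable_error (e.erase j) i).const_mul _).const_mul _

theorem average_mem_Icc {n p : ℕ} (hp : 1 ≤ p) (hpn : p ≤ n) {b : Finset (Fin n) → Fin n → ℝ}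
    {s : Finset (Fin n) → Finset (Fin n)} (hs : ∀ e, s e ⊆ eᶜ)
    (hb : ∀ e i, b e i ∈ Set.Icc 0 1) :
    ((n.choose p : ℕ) : ℝ)⁻¹ * ∑ e ∈ (Finset.univ : Finset (Fin n)).powersetCard (n - p),
      (1 / (p : ℝ)) * ∑ i ∈ s e, b e i ∈ Set.Icc (0 : ℝ) 1 := by
  have hp' : (0 : ℝ) < p := by exact_mod_cast hp
  have hC : (0 : ℝ) < (n.choose p : ℕ) := by exact_mod_cast Nat.choose_pos hpn
  constructor
  · exact mul_nonneg (inv_nonneg.2 hC.le) (Finset.sum_nonneg fun e _ =>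
      mul_nonneg (by positivity) (Finset.sum_nonneg fun i _ => (hb e i).1))
  · have h : ∀ e ∈ (Finset.univ : Finset (Fin n)).powersetCard (n - p),
        (1 / (p : ℝ)) * ∑ i ∈ s e, b e i ≤ 1 := by
      intro e he
      have h1 : (s e).card ≤ p := by
        refine (Finset.card_le_card (hs e)).trans ?_
        rw [Finset.card_compl, (Finset.mem_powersetCard.1 he).2, Fintype.card_fin]
        omega
      have h2 : ∑ i ∈ s e, b e i ≤ (s e).card • (1 : ℝ) :=
        Finset.sum_le_card_nsmul _ _ _ fun i _ => (hb e i).2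
      rw [one_div, inv_mul_le_one₀ hp']
      refine h2.trans ?_
      simpa using h1
    have h3 := Finset.sum_le_card_nsmul _ _ _ h
    rw [inv_mul_le_one₀ hC]
    refine h3.trans ?_
    rw [Finset.card_powersetCard, Finset.card_univ, Fintype.card_fin, Nat.choose_symm hpn]
    simp

theorem leavePOut_mem_Icc {d n p k : ℕ} (hp : 1 ≤ p) (hpn : p ≤ n)
    (z : Fin n → EuclideanSpace ℝ (Fin d) × Fin 2) : leavePOut p k z ∈ Set.Icc (0 : ℝ) 1 := by
  refine average_mem_Icc hp hpn (s := fun e => eᶜ) (fun e => Finset.Subset.refl eᶜ)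
    (b := fun e i => if classifier k z e (z i).1 ≠ (z i).2 then 1 else 0) fun e i => ?_
  by_cases h : classifier k z e (z i).1 = (z i).2 <;> simp [h]

theorem leavePOutErase_mem_Icc {d n p k : ℕ} (hp : 1 ≤ p) (hpn : p ≤ n) (j : Fin n)
    (z : Fin n → EuclideanSpace ℝ (Fin d) × Fin 2) :
    leavePOutErase p k j z ∈ Set.Icc (0 : ℝ) 1 := by
  refine average_mem_Icc hp hpn (s := fun e => eᶜ.erase j) (fun e => Finset.erase_subset _ _)
    (b := fun e i => if classifier k z (e.erase j) (z i).1 ≠ (z i).2 then 1 else 0) fun e i => ?_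
  split_ifs <;> simp

theorem leavePOutErase_update {d n : ℕ} (p k : ℕ) (j : Fin n)
    (z : Fin n → EuclideanSpace ℝ (Fin d) × Fin 2) (y : EuclideanSpace ℝ (Fin d) × Fin 2) :
    leavePOutErase p k j (Function.update z j y) = leavePOutErase p k j z := by
  unfold leavePOutErase
  refine congrArg (_ * ·) (Finset.sum_congr rfl fun e _ =>
    congrArg (_ * ·) (Finset.sum_congr rfl fun i hi => ?_))
  have hz : ∀ {l : Fin n}, l ≠ j → Function.update z j y l = z l := fun h =>
    Function.update_of_ne h _ _
  rw [hz (Finset.ne_of_mem_erase hi)]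
  have hN : neighbors k (fun i => (Function.update z j y i).1) (e.erase j) (z i).1
      = neighbors k (fun i => (z i).1) (e.erase j) (z i).1 := by
    refine Finset.filter_congr fun l hl => ?_
    have : ((e.erase j).filter fun l' => dist (z i).1 (Function.update z j y l').1
        < dist (z i).1 (Function.update z j y l).1)
        = (e.erase j).filter fun l' => dist (z i).1 (z l').1 < dist (z i).1 (z l).1 :=
      Finset.filter_congr fun l' hl' => by
        rw [hz (Finset.ne_of_mem_erase hl), hz (Finset.ne_of_mem_erase hl')]
    rw [this]
  have hc : classifier k (Function.update z j y) (e.erase j) (z i).1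
      = classifier k z (e.erase j) (z i).1 := by
    unfold classifier
    rw [hN, Finset.sum_congr rfl fun l hl => by
      rw [hz (Finset.ne_of_mem_erase (mem_neighbors.1 hl).1)]]
  rw [hc]

theorem half_lt_kappa : 1 / 2 < kappa := by
  have h : 1 < Real.sqrt (Real.exp 1) := by
    rw [Real.lt_sqrt zero_le_one]
    simp
  unfold kappa
  rw [div_lt_div_iff₀ two_pos (by linarith)]
  linarith

theorem le_squareConstant (d : ℕ) : 512 * (1 + stoneConstant d) ≤ squareConstant d := by
  have h1 := half_lt_kappa
  have h2 : 1 < Real.exp 1 := Real.one_lt_exp_iff.2 zero_lt_one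
  have h3 : 1 / 2 ≤ Real.exp 1 * kappa := by nlinarith
  have h4 := stoneConstant_nonneg d
  unfold squareConstant
  nlinarith

/-- Both tails of the leave-`p`-out estimator, for independent observations. -/
theorem measureReal_leavePOut_tail_le {d n p k : ℕ} (hp : 1 ≤ p) (hk : 1 ≤ k) (hpn : p ≤ n)
    (ν : Fin n → Measure (EuclideanSpace ℝ (Fin d) × Fin 2)) [∀ i, IsProbabilityMeasure (ν i)]
    (hties : ∀ᵐ z ∂Measure.pi ν, NoDistanceTies fun i => (z i).1)
    {t : ℝ} (ht : 0 < t) :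
    (Measure.pi ν).real {z | leavePOut p k z - ∫ z', leavePOut p k z' ∂Measure.pi ν > t}
        ≤ Real.exp (-(t ^ 2 / (4 * ((k : ℝ) ^ 2 * (3 + stoneConstant d) / n)))) ∧
      (Measure.pi ν).real {z | ∫ z', leavePOut p k z' ∂Measure.pi ν - leavePOut p k z > t}
        ≤ Real.exp (-(t ^ 2 / (4 * ((k : ℝ) ^ 2 * (3 + stoneConstant d) / n)))) := by
  have hγ := stoneConstant_nonneg d
  have hn : (0 : ℝ) < n := by exact_mod_cast hp.trans hpn
  have hk' : (1 : ℝ) ≤ k := by exact_mod_cast hk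
  have hR := fun z => leavePOut_mem_Icc (d := d) (k := k) hp hpn z
  have hRj := fun j z => leavePOutErase_mem_Icc (d := d) (k := k) hp hpn j z
  have hER : ∫ z', leavePOut p k z' ∂Measure.pi ν ∈ Set.Icc (0 : ℝ) 1 := by
    have hi := integrable_of_mem_Icc (μ := Measure.pi ν) (measurable_leavePOut p k) hR
    constructor
    · exact integral_nonneg fun z => (hR z).1
    · simpa using integral_mono hi (integrable_const (1 : ℝ)) fun z => (hR z).2
  -- For t ≥ 1 both events are empty; t < 1 is what keeps the Chernoff parameter admissible in
  -- `htM`.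
  rcases le_or_gt 1 t with ht1 | ht1
  · constructor
    · rw [Set.eq_empty_of_forall_notMem (s := {z | _ > t}) fun z hz => ?_]
      · simpa using (Real.exp_pos _).le
      · have : t < leavePOut p k z - ∫ z', leavePOut p k z' ∂Measure.pi ν := hz
        linarith [(hR z).2, hER.1]
    · rw [Set.eq_empty_of_forall_notMem (s := {z | _ > t}) fun z hz => ?_]
      · simpa using (Real.exp_pos _).le
      · have : t < ∫ z', leavePOut p k z' ∂Measure.pi ν - leavePOut p k z := hz
        linarith [(hR z).1, hER.2]
  have hM0 : 0 ≤ (1 + stoneConstant d * k) / n := by positivity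
  have hv0 : 0 < (k : ℝ) ^ 2 * (3 + stoneConstant d) / n := by positivity
  have htM : t * ((1 + stoneConstant d * k) / n)
      ≤ 2 * ((k : ℝ) ^ 2 * (3 + stoneConstant d) / n) := by
    rw [← mul_div_assoc, ← mul_div_assoc]
    refine div_le_div_of_nonneg_right ?_ hn.le
    have h1 : (k : ℝ) ≤ k ^ 2 := by nlinarith
    have h2 : stoneConstant d * k ≤ stoneConstant d * (k : ℝ) ^ 2 :=
      mul_le_mul_of_nonneg_left h1 hγ
    have h3 : t * (1 + stoneConstant d * k) ≤ 1 * (1 + stoneConstant d * k) :=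
      mul_le_mul_of_nonneg_right ht1.le (by positivity)
    nlinarith
  have hM : ∀ᵐ z ∂Measure.pi ν, ∀ j, |leavePOut p k z - leavePOutErase p k j z|
      ≤ (1 + stoneConstant d * k) / n := by
    filter_upwards [hties] with z hz j using abs_leavePOut_sub_le hp hpn hz j
  have hv : ∀ᵐ z ∂Measure.pi ν, ∑ j, (leavePOut p k z - leavePOutErase p k j z) ^ 2
      ≤ (k : ℝ) ^ 2 * (3 + stoneConstant d) / n := by
    filter_upwards [hties] with z hz using sum_sq_leavePOut_sub_le hp hk hpn hz
  have habs : ∀ {r : ℝ}, r ∈ Set.Icc (0 : ℝ) 1 → |r| ≤ 1 := fun hr => by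
    rw [abs_of_nonneg hr.1]; exact hr.2
  constructor
  · refine (measureReal_mono fun z hz => ?_).trans (measureReal_pi_ge_le_exp (ν := ν)
      (measurable_leavePOut p k) (measurable_leavePOutErase p k) (fun z => habs (hR z))
      (fun j z => habs (hRj j z)) (leavePOutErase_update p k) hM hv hM0 hv0 ht htM)
    have : t < leavePOut p k z - ∫ z', leavePOut p k z' ∂Measure.pi ν := hz
    exact this.le
  · refine (measureReal_mono fun z hz => ?_).trans (measureReal_pi_ge_le_exp (ν := ν) (B := 1)
      (F := fun j z => -leavePOutErase p k j z) (M := (1 + stoneConstant d * k) / n)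
      (measurable_leavePOut p k).neg (fun j => (measurable_leavePOutErase p k j).neg)
      (fun z => ?_) (fun j z => ?_) (fun j z y => ?_) ?_ ?_ hM0 hv0 ht htM)
    · have : t < ∫ z', leavePOut p k z' ∂Measure.pi ν - leavePOut p k z := hz
      simp only [Set.mem_ofPred_eq, Pi.neg_apply, integral_neg]
      linarith
    · simpa using habs (hR z)
    · simpa using habs (hRj j z)
    · simp only [leavePOutErase_update]
    · filter_upwards [hM] with z hz j
      rw [Pi.neg_apply, neg_sub_neg, abs_sub_comm]
      exact hz j
    · filter_upwards [hv] with z hz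
      refine le_of_eq_of_le (Finset.sum_congr rfl fun j _ => ?_) hz
      rw [Pi.neg_apply]
      ring

end KNN

theorem mainTheorem6 (d n p k : ℕ) (hp : 1 ≤ p) (hk : 1 ≤ k) (hpk : p + k ≤ n)
    {Ω : Type*} [MeasurableSpace Ω] (μ : MeasureTheory.Measure Ω)
    [MeasureTheory.IsProbabilityMeasure μ]
    (Z : Fin n → Ω → EuclideanSpace ℝ (Fin d) × Fin 2)
    (hmeas : ∀ i, Measurable (Z i))
    (hindep : ProbabilityTheory.iIndepFun Z μ)
    (hident : ∀ i j, ProbabilityTheory.IdentDistrib (Z i) (Z j) μ μ)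
    (hties : ∀ᵐ ω ∂μ, KNN.NoDistanceTies fun i => (Z i ω).1) :
    0 < KNN.squareConstant d ∧ ∀ t : ℝ, 0 < t →
      max
        (μ.real {ω | KNN.leavePOut p k (fun i => Z i ω)
          - (∫ ω', KNN.leavePOut p k (fun i => Z i ω') ∂μ) > t})
        (μ.real {ω | (∫ ω', KNN.leavePOut p k (fun i => Z i ω') ∂μ)
          - KNN.leavePOut p k (fun i => Z i ω) > t})
      ≤ Real.exp (-((n : ℝ) * t ^ 2 /
          (KNN.squareConstant d * (k : ℝ) ^ 2 *
            (1 + ((k : ℝ) + p) * (((p : ℝ) - 1) / ((n : ℝ) - 1)))))) := by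
  have hγ := KNN.stoneConstant_nonneg d
  have hsq := KNN.le_squareConstant d
  refine ⟨by linarith, fun t ht => ?_⟩
  have hp' : (1 : ℝ) ≤ p := by exact_mod_cast hp
  have hk' : (1 : ℝ) ≤ k := by exact_mod_cast hk
  have hpk' : (p : ℝ) + k ≤ n := by exact_mod_cast hpk
  have hZ : Measurable fun ω i => Z i ω := measurable_pi_lambda _ hmeas
  have hmap : μ.map (fun ω i => Z i ω) = Measure.pi fun i => μ.map (Z i) :=
    (ProbabilityTheory.iIndepFun_iff_map_fun_eq_pi_map fun i => (hmeas i).aemeasurable).1 hindep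
  have hprob : ∀ i, IsProbabilityMeasure (μ.map (Z i)) := fun i =>
    Measure.isProbabilityMeasure_map (hmeas i).aemeasurable
  have hR := KNN.measurable_leavePOut (d := d) (n := n) p k
  have hint : ∫ ω', KNN.leavePOut p k (fun i => Z i ω') ∂μ
      = ∫ z, KNN.leavePOut p k z ∂Measure.pi fun i => μ.map (Z i) := by
    rw [← hmap, integral_map hZ.aemeasurable hR.aestronglyMeasurable]
  have hties' : ∀ᵐ z ∂Measure.pi fun i => μ.map (Z i), KNN.NoDistanceTies fun i => (z i).1 := by
    rw [← hmap]
    exact (ae_map_iff hZ.aemeasurable KNN.measurableSet_noDistanceTies).2 hties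
  obtain ⟨h1, h2⟩ := KNN.measureReal_leavePOut_tail_le hp hk (by omega) _ hties' ht
  have hle : Real.exp (-(t ^ 2 / (4 * ((k : ℝ) ^ 2 * (3 + KNN.stoneConstant d) / n))))
      ≤ Real.exp (-((n : ℝ) * t ^ 2 / (KNN.squareConstant d * (k : ℝ) ^ 2 *
            (1 + ((k : ℝ) + p) * (((p : ℝ) - 1) / ((n : ℝ) - 1)))))) := by
    have hn : (0 : ℝ) < n := by linarith
    rw [Real.exp_le_exp, neg_le_neg_iff]
    have e : t ^ 2 / (4 * ((k : ℝ) ^ 2 * (3 + KNN.stoneConstant d) / n))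
        = n * t ^ 2 / (4 * (3 + KNN.stoneConstant d) * (k : ℝ) ^ 2 * 1) := by
      field_simp
    rw [e]
    -- The bracket only weakens the bound already obtained, so its nonnegative second term is
    -- compared with 0.
    have hq : 0 ≤ ((k : ℝ) + p) * (((p : ℝ) - 1) / ((n : ℝ) - 1)) :=
      mul_nonneg (by linarith) (div_nonneg (by linarith) (by linarith))
    refine div_le_div_of_nonneg_left (by positivity) (by positivity) ?_
    refine mul_le_mul (mul_le_mul_of_nonneg_right (by linarith) (by positivity)) (by linarith)
      zero_le_one (mul_nonneg (by linarith) (by positivity))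
  refine max_le ?_ ?_
  · refine le_trans (le_of_eq ?_) (h1.trans hle)
    rw [← hint, ← hmap, map_measureReal_apply hZ]
    · rfl
    · exact measurableSet_lt measurable_const (hR.sub_const _)
  · refine le_trans (le_of_eq ?_) (h2.trans hle)
    rw [← hint, ← hmap, map_measureReal_apply hZ]
    · rfl
    · exact measurableSet_lt measurable_const (hR.const_sub _)
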